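/- **Setting.** Fix $D\in\mathbb N$ and real numbers $\Omega>0$, $m$, $M>1$, with $D\ge 1$ or $m\neq 0$. For $t>0$ and $p,q\in\mathbb R^D$ let $$\hat C(t,p,q)=\frac{e^{-m^2t}}{\sinh^{D/2}(2\Omega t)}\exp\Big(-\frac{1}{4\Omega}\coth(\Omega t)(p+q)^2-\frac{1}{4\Omega}\tanh(\Omega t)(p-q)^2\Big)$$ (the integrand of the momentum-space propagator of the Euclidean $\phi^4$ theory on $\mathbb R^D$ with quadratic part $\frac12(\partial\phi)^2+\frac{\Omega^2}{2}x^2\phi^2+\frac{m^2}{2}\phi^2$), and define its slices $$\hat C^0(p,q)=\Big(\frac{2\pi}{\Omega}\Big)^{D/2}\int_1^\infty dt\,\hat C(t,p,q),\qquad \hat C^i(p,q)=\Big(\frac{2\pi}{\Omega}\Big)^{D/2}\int_{M^{-2i}}^{M^{-2(i-1)}}dt\,\hat C(t,p,q)\quad(i\ge1).$$ Let $G$ be a connected amputated $\phi^4$ Feynman graph: finitely many vertices, internal lines and external legs, in which each vertex has exactly four slots and each of the two ends of every internal line, and each external leg, is hooked to one slot, all slots being used exactly once (multiple lines and self-loops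 are allowed). Let $\mathcal I(G)$ be the set of internal lines and let $G$ have $N>0$ external legs; then $N$ is even, so $N\ge2$. Let $\Delta$ be the product over all vertices of $\delta(\text{sum of the four incoming momenta})$. For an attribution $\mu=\{i_\ell\}_{\ell\in\mathcal I(G)}\in\{0,\dots,\rho\}^{\mathcal I(G)}$, where $\rho\in\mathbb N$, put $$A_G^\mu(k_1,\dots,k_N)=\int\prod_{\ell\in\mathcal I(G)}d^Dp_\ell\,d^Dq_\ell\;\hat C^{i_\ell}(p_\ell,q_\ell)\;\Delta(\{p_\ell,q_\ell,k_e\}),$$ a distribution in the incoming external momenta $k_1,\dots,k_N$; here $p_\ell,q_\ell$ are the incoming momenta at the two ends of $\ell$. For $0\le i\le\rho$, the quasilocal subgraphs $G^i_k$ are the connected components of the subgraph of $G$ formed by the lines with $i_\ell\ge i$ and the vertices hooked to them (for $i=0$ this subgraph is $G$ itself, also if $G$ has no internal line). For a connected subgraph $H$ with $n(H)$ vertices and $N(H)$ external legs (the slots at vertices of $H$ not occupied by internal lines of $H$), let $$\omega(H)=(4-D)\,n(H)+\tfrac12(D-2)\,N(H)-D .$$ Write $\hat\varphi(p)=\int d^Dx\,\varphi(x)e^{-ipx}$.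 **Theorem (power counting).** There is a constant $K>0$, depending on $D,\Omega,m,M$ and $G$ but not on $\rho$ or $\mu$, such that for every $\rho$, every attribution $\mu\in\{0,\dots,\rho\}^{\mathcal I(G)}$, all Schwartz functions $\varphi_1,\dots,\varphi_N\in\mathcal S(\mathbb R^D)$ and every numbering of the external legs, the integral below converges absolutely and $$\Big|\int d^Dk_1\cdots d^Dk_N\,A_G^\mu(k_1,\dots,k_N)\,\hat\varphi_1(k_1)\cdots\hat\varphi_N(k_N)\Big|\le K\,\|\hat\varphi_1\|_1\cdots\|\hat\varphi_{N-2}\|_1\,\|\hat\varphi_{N-1}\|_2\,\|\hat\varphi_N\|_2\prod_{(i,k)}M^{-\omega(G^i_k)},$$ where the product runs over all pairs $(i,k)$ with $0\le i\le\rho$ and $G^i_k$ a quasilocal subgraph of scale $i$ (a subgraph occurring at several scales is counted once for each of them). -/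

import Mathlib

/-- Momentum (or position) space `ℝ^D` with its Euclidean structure. -/
abbrev Mom (D : ℕ) : Type := EuclideanSpace ℝ (Fin D)

/-- An amputated Feynman graph of a scalar theory with quartic interaction: a set `V` of vertices,
each with four slots, a set `L` of internal lines, each with two ends, and a set `E` of external
legs. Every end of an internal line and every external leg is hooked to one slot, and every slot is
used exactly once. Multiple lines between two vertices and lines from a vertex to itself are
allowed. -/
structure Phi4Graph (V L E : Type*) where
  /-- the slot to which a line end, or an external leg, is hooked -/
  slot : (L × Bool) ⊕ E ≃ V × Fin 4

namespace Phi4Graph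

variable {V L E : Type*}

/-- The vertex at an end of an internal line. -/
def endpt (G : Phi4Graph V L E) (l : L) (b : Bool) : V := (G.slot (Sum.inl (l, b))).1

/-- A subgraph: a set of vertices and a set of internal lines with both ends on these vertices. -/
structure Sub (G : Phi4Graph V L E) where
  /-- the vertices of the subgraph -/
  verts : Set V
  /-- the internal lines of the subgraph -/
  lines : Set L
  endpt_mem : ∀ l ∈ lines, ∀ b, G.endpt l b ∈ verts

/-- The whole graph as a subgraph of itself. -/
def whole (G : Phi4Graph V L E) : G.Sub where
  verts := Set.univ
  lines := Set.univ
  endpt_mem := fun _ _ _ => Set.mem_univ _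

namespace Sub

variable {G : Phi4Graph V L E}

/-- Two distinct vertices of the subgraph are adjacent if a line of the subgraph joins them. -/
def adjGraph (H : G.Sub) : SimpleGraph H.verts :=
  SimpleGraph.fromRel fun v w => ∃ l ∈ H.lines, G.endpt l false = v ∧ G.endpt l true = w

/-- The subgraph is connected (in particular it has a vertex). -/
def Connected (H : G.Sub) : Prop := H.adjGraph.Connected

/-- The connected component `c` of `H`: its vertices, and all lines of `H` attached to them. -/
def component (H : G.Sub) (c : H.adjGraph.ConnectedComponent) : G.Sub where
  verts := {v | ∃ hv : v ∈ H.verts, H.adjGraph.connectedComponentMk ⟨v, hv⟩ = c}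
  lines := {l | ∃ hl : l ∈ H.lines,
    H.adjGraph.connectedComponentMk ⟨G.endpt l false, H.endpt_mem l hl false⟩ = c}
  endpt_mem := by
    rintro l ⟨hl, hc⟩ b
    refine ⟨H.endpt_mem l hl b, ?_⟩
    cases b with
    | false => exact hc
    | true =>
      rw [← hc]
      by_cases h : G.endpt l true = G.endpt l false
      · congr 1
        exact Subtype.ext h
      · refine SimpleGraph.ConnectedComponent.sound (SimpleGraph.Adj.reachable ?_)
        refine (SimpleGraph.fromRel_adj _ _ _).2 ⟨fun h' => h (congrArg Subtype.val h'), Or.inr ?_⟩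
        exact ⟨l, hl, rfl, rfl⟩

/-- The number `n` of vertices. -/
noncomputable def numVerts (H : G.Sub) : ℕ := H.verts.ncard

/-- The number `N` of external legs: the slots at vertices of `H` not taken by internal lines of
`H`. (They carry external legs of `G` or ends of internal lines of `G` that are not in `H`.) -/
noncomputable def numLegs (H : G.Sub) : ℕ :=
  {s : V × Fin 4 | s.1 ∈ H.verts ∧ ∀ l ∈ H.lines, ∀ b, G.slot (Sum.inl (l, b)) ≠ s}.ncard

/-- The superficial degree of divergence `ω = (4 - D) n + (D - 2) N / 2 - D`. -/
noncomputable def omega (D : ℕ) (H : G.Sub) : ℝ :=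
  (4 - (D : ℝ)) * H.numVerts + ((D : ℝ) - 2) * H.numLegs / 2 - D

end Sub

/-- For an attribution `μ` of scales to the internal lines, the subgraph formed by the lines of
index at least `i` and the vertices hooked to them; for `i = 0` it is all of `G` (by convention
also if `G` has no line). -/
def scaleSub (G : Phi4Graph V L E) (μ : L → ℕ) (i : ℕ) : G.Sub where
  verts := {v | i = 0 ∨ ∃ l, i ≤ μ l ∧ ∃ b, G.endpt l b = v}
  lines := {l | i ≤ μ l}
  endpt_mem := fun l hl b => Or.inr ⟨l, hl, b, rfl⟩

end Phi4Graph

/-- The integrand `Ĉ(t, p, q)` of the momentum space propagator of `-∂² + Ω² x² + m²`. -/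
noncomputable def propagatorKernel (D : ℕ) (Ω m t : ℝ) (p q : Mom D) : ℝ :=
  Real.exp (-m ^ 2 * t) / Real.sinh (2 * Ω * t) ^ ((D : ℝ) / 2) *
    Real.exp (-(1 / (4 * Ω)) * (Real.cosh (Ω * t) / Real.sinh (Ω * t)) * ‖p + q‖ ^ 2
      - 1 / (4 * Ω) * Real.tanh (Ω * t) * ‖p - q‖ ^ 2)

/-- The range of the parameter `t` in the slice of scale `i`: `[1, ∞)` for `i = 0` and
`[M^(-2i), M^(-2(i-1))]` for `i ≥ 1`. -/
def sliceRange (M : ℝ) : ℕ → Set ℝ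
  | 0 => Set.Ici 1
  | i + 1 => Set.Icc ((M ^ (2 * (i + 1)))⁻¹) ((M ^ (2 * i))⁻¹)

/-- The propagator `Ĉ^i(p, q)` in the slice of scale `i`. -/
noncomputable def slicePropagator (D : ℕ) (Ω m M : ℝ) (i : ℕ) (p q : Mom D) : ℝ :=
  (2 * Real.pi / Ω) ^ ((D : ℝ) / 2) *
    ∫ t in sliceRange M i, propagatorKernel D Ω m t p q

/-- The measure `δ(p₀ + p₁ + p₂ + p₃) dp₀ dp₁ dp₂ dp₃` of momentum conservation at a vertex. -/
noncomputable def vertexDelta (D : ℕ) : MeasureTheory.Measure (Fin 4 → Mom D) :=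
  MeasureTheory.Measure.map
    (fun p : Fin 3 → Mom D => ![p 0, p 1, p 2, -(p 0 + p 1 + p 2)]) MeasureTheory.volume

/-- The Fourier transform `f̂(p) = ∫ f(x) e^{-ipx} dx`. -/
noncomputable def fourierHat {D : ℕ} (f : Mom D → ℂ) (p : Mom D) : ℂ :=
  ∫ x, f x * Complex.exp (-Complex.I * (inner ℝ p x : ℝ))

namespace Phi4Graph

variable {V L E : Type*} [Fintype V] [Fintype L] [Fintype E]

/-- The product `Δ` of the delta functions of all vertices, together with Lebesgue measure, as a
measure on the incoming momenta at all slots. -/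
noncomputable def deltaMeasure (_G : Phi4Graph V L E) (D : ℕ) :
    MeasureTheory.Measure (V → Fin 4 → Mom D) :=
  MeasureTheory.Measure.pi fun _ => vertexDelta D

/-- The incoming momentum at the slot of a line end or external leg. -/
def momentum (G : Phi4Graph V L E) {D : ℕ} (P : V → Fin 4 → Mom D) (h : (L × Bool) ⊕ E) : Mom D :=
  P (G.slot h).1 (G.slot h).2

/-- The product of the slice propagators of all internal lines and of the test functions `f e` at
the momenta of the external legs. -/
noncomputable def amplitudeIntegrand (G : Phi4Graph V L E) (D : ℕ) (Ω m M : ℝ) (μ : L → ℕ)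
    (f : E → Mom D → ℂ) (P : V → Fin 4 → Mom D) : ℂ :=
  (∏ l, (slicePropagator D Ω m M (μ l) (G.momentum P (Sum.inl (l, false)))
      (G.momentum P (Sum.inl (l, true))) : ℂ)) *
    ∏ e, f e (G.momentum P (Sum.inr e))

/-- The amplitude `∫ dk₁ … dk_N A_G^μ(k₁, …, k_N) f₁(k₁) ⋯ f_N(k_N)` of `G` with attribution `μ`,
smeared with the test functions `f e`. -/
noncomputable def smearedAmplitude (G : Phi4Graph V L E) (D : ℕ) (Ω m M : ℝ) (μ : L → ℕ)
    (f : E → Mom D → ℂ) : ℂ :=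
  ∫ P, G.amplitudeIntegrand D Ω m M μ f P ∂(G.deltaMeasure D)

end Phi4Graph

/-!
A line `l` of scale `i` with momenta `p`, `q` at its ends carries at most
`K M ^ ((D - 2) i) exp (-c M ^ (2 i) ‖p + q‖²) exp (-c M ^ (-2 i) ‖p - q‖²)`
(`exists_slicePropagator_le`). Integrated over `p + q` this gives `M ^ (-2 i)` up to a constant, and a
further integration over `p - q` gives back the factor `M ^ (D i)`.

Let `T` be a spanning tree. On the momenta conserved at all vertices, the sums `p + q` of all lines,
the differences `p - q` of the lines outside `T`, and the momenta of all external legs but one leg `b`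
are linear coordinates: if they vanish, the remaining momenta flow along the tree only, and are zero
because the incidence vectors of the lines of `T` are linearly independent
(`Phi4Graph.eq_zero_of_linearIndepOn`); the dimensions agree by counting slots. So `Δ` is a multiple
of the Lebesgue measure in these coordinates. The momentum of `b` is minus the sum of all `p + q` and
all other external momenta, and the Cauchy–Schwarz inequality in the momentum of a second leg `a`
bounds the two test functions by their `L²` norms. Everything else is a product of functions of one
coordinate each (`Phi4Graph.exists_lintegral_deltaMeasure_le`). The result is the product of
`M ^ ((D - 2) i_l)` over all lines and of `M ^ (-D i_l)` over the lines of `T`.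

It remains to choose `T` well. For a subgraph with `n` vertices and `L` lines,
`-ω = (D - 2) L - D (n - 1)`, so the exponents of the theorem add up to those found above, up to
constants, if the lines of `T` of scale at least `i` number at least the vertices minus the components
of the subgraph of scale `i`, for every `i`. A maximal tree in the sense of Kruskal's algorithm has
this property (`Phi4Graph.exists_scaled_spanningTree`). It depends on the attribution, but there are
only finitely many trees, so the constants are uniform.
-/

open MeasureTheory

/-! ### Spanning trees adapted to an attribution of scales, and degrees of divergence -/

/-- Kruskal's algorithm, in terms of linear algebra: for a family of vectors with bounded weights `μ`
there is a linearly independent subfamily which, for every threshold `i`, already spans all vectors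
of weight at least `i`. It is built by adding the weights in decreasing order. -/
theorem exists_linearIndepOn_forall_span_superlevel {L W : Type*} [AddCommGroup W] [Module ℝ W]
    (v : L → W) (μ : L → ℕ) (ρ : ℕ) (hμ : ∀ l, μ l ≤ ρ) :
    ∃ T : Set L, LinearIndepOn ℝ v T ∧
      ∀ i, v '' {l | i ≤ μ l} ⊆ Submodule.span ℝ (v '' {l ∈ T | i ≤ μ l}) := by
  have key : ∀ k : ℕ, ∃ T : Set L, T ⊆ {l | ρ < μ l + k} ∧ LinearIndepOn ℝ v T ∧
      ∀ i, ρ < i + k → v '' {l | i ≤ μ l} ⊆ Submodule.span ℝ (v '' {l ∈ T | i ≤ μ l}) := by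
    intro k
    induction k with
    | zero =>
      refine ⟨∅, Set.empty_subset _, linearIndepOn_empty ℝ v, fun i hi => ?_⟩
      rintro _ ⟨l, hl, rfl⟩
      have := hμ l
      simp only [Set.mem_ofPred_eq] at hl
      omega
    | succ k ih =>
      obtain ⟨T, hTs, hT, hspan⟩ := ih
      obtain ⟨T', hT's, hTT', hspan', hT'⟩ := exists_linearIndepOn_extension hT
        (t := {l | ρ < μ l + (k + 1)}) (fun l hl => by have := hTs hl; simp at this ⊢; omega)
      refine ⟨T', hT's, hT', fun i hi => ?_⟩
      by_cases hik : ρ < i + k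
      · refine (hspan i hik).trans (Submodule.span_mono (Set.image_mono ?_))
        exact fun l hl => ⟨hTT' hl.1, hl.2⟩
      · have h1 : {l | i ≤ μ l} = {l | ρ < μ l + (k + 1)} := by
          ext l; simp only [Set.mem_ofPred_eq]; omega
        have h2 : {l ∈ T' | i ≤ μ l} = T' := by
          ext l
          refine ⟨fun h => h.1, fun h => ⟨h, ?_⟩⟩
          have := hT's h
          rwa [← h1] at this
        rw [h1, h2]
        exact hspan'
  obtain ⟨T, -, hT, hspan⟩ := key (ρ + 1)
  exact ⟨T, hT, fun i => hspan i (by omega)⟩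

theorem Set.ncard_eq_sum_ncard_fiber {α C : Type*} [Finite α] [Fintype C] (S : Set α)
    (f : S → C) : S.ncard = ∑ c, {x | ∃ h : x ∈ S, f ⟨x, h⟩ = c}.ncard := by
  have h1 : ∀ c, {x | ∃ h : x ∈ S, f ⟨x, h⟩ = c}.ncard = Nat.card {x : S // f x = c} := by
    intro c
    rw [← Nat.card_coe_set_eq]
    exact Nat.card_congr ⟨fun x => ⟨⟨x.1, x.2.1⟩, x.2.2⟩, fun x => ⟨x.1.1, x.1.2, x.2⟩,
      fun _ => rfl, fun _ => rfl⟩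
  simp_rw [h1]
  rw [← Nat.card_coe_set_eq, ← Nat.card_sigma]
  exact Nat.card_congr (Equiv.sigmaFiberEquiv f).symm

namespace Phi4Graph

variable {V L E : Type*}

open scoped Classical in
/-- The incidence vector `e_v - e_w` of an internal line with ends at `v` and `w` (zero for a line
from a vertex to itself). Sets of lines with linearly independent incidence vectors are the
forests. -/
noncomputable def edgeVec (G : Phi4Graph V L E) (l : L) : V → ℝ :=
  Pi.single (G.endpt l false) 1 - Pi.single (G.endpt l true) 1

open scoped Classical in
/-- The incidence vectors of a subgraph together with one basis vector per component span the basis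
vectors of all its vertices, so their rank is at least the number of vertices minus the number of
components. -/
theorem Sub.ncard_verts_le_finrank_span [Finite V] {G : Phi4Graph V L E} (H : G.Sub) :
    H.verts.ncard ≤ Module.finrank ℝ (Submodule.span ℝ (G.edgeVec '' H.lines)) +
      Nat.card H.adjGraph.ConnectedComponent := by
  have := Fintype.ofFinite V
  have := Fintype.ofFinite H.adjGraph.ConnectedComponent
  set S := Submodule.span ℝ (G.edgeVec '' H.lines)
  set e : V → (V → ℝ) := fun v => Pi.single v 1
  set R := Submodule.span ℝ (Set.range fun c : H.adjGraph.ConnectedComponent => e c.out.1)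
  have hadj : ∀ v w : H.verts, H.adjGraph.Adj v w → e v - e w ∈ S := by
    intro v w h
    obtain ⟨-, ⟨l, hl, h1, h2⟩ | ⟨l, hl, h1, h2⟩⟩ := (SimpleGraph.fromRel_adj _ _ _).1 h
    · refine Submodule.subset_span ⟨l, hl, ?_⟩
      simp [edgeVec, h1, h2, e]
    · rw [← neg_sub]
      refine S.neg_mem (Submodule.subset_span ⟨l, hl, ?_⟩)
      simp [edgeVec, h1, h2, e]
  -- telescoping along a walk
  have hreach : ∀ v w : H.verts, H.adjGraph.Reachable v w → e v - e w ∈ S := by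
    rintro v w ⟨p⟩
    induction p with
    | nil => simp
    | cons h _ ih => simpa using S.add_mem (hadj _ _ h) ih
  have hmem : ∀ v : H.verts, e v ∈ S ⊔ R := by
    intro v
    have h1 := hreach v (H.adjGraph.connectedComponentMk v).out
      (SimpleGraph.ConnectedComponent.exact (Quot.out_eq _).symm)
    have h2 : e (H.adjGraph.connectedComponentMk v).out.1 ∈ R := Submodule.subset_span ⟨_, rfl⟩
    simpa using Submodule.add_mem_sup h1 h2
  have hind : LinearIndependent ℝ fun v : H.verts => e v := by
    have : LinearIndependent ℝ e := by
      have h : e = Pi.basisFun ℝ V := by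
        funext v
        simp [e]
      exact h ▸ (Pi.basisFun ℝ V).linearIndependent
    exact this.comp _ Subtype.val_injective
  have h1 : H.verts.ncard =
      Module.finrank ℝ (Submodule.span ℝ (Set.range fun v : H.verts => e v)) := by
    rw [finrank_span_eq_card hind, ← Nat.card_coe_set_eq, Nat.card_eq_fintype_card]
  rw [h1]
  calc _ ≤ Module.finrank ℝ ↥(S ⊔ R) := Submodule.finrank_mono (Submodule.span_le.2 (by
          rintro _ ⟨v, rfl⟩; exact hmem v))
    _ ≤ Module.finrank ℝ S + Module.finrank ℝ R := Submodule.finrank_add_le_finrank_add_finrank S R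
    _ ≤ _ := by
      gcongr
      rw [Nat.card_eq_fintype_card]
      exact finrank_range_le_card _

/-- A spanning tree `T` adapted to the attribution `μ`: its lines of scale at least `i` form a
spanning forest of the subgraph of scale `i`, for every `i`. -/
theorem exists_scaled_spanningTree [Finite V] [Fintype L] (G : Phi4Graph V L E)
    (hG : G.whole.Connected) (ρ : ℕ) (μ : L → ℕ) (hμ : ∀ l, μ l ≤ ρ) :
    ∃ T : Finset L, LinearIndepOn ℝ G.edgeVec (T : Set L) ∧ Nat.card V ≤ T.card + 1 ∧
      ∀ i, (G.scaleSub μ i).verts.ncard ≤ (T.filter fun l => i ≤ μ l).card +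
        Nat.card (G.scaleSub μ i).adjGraph.ConnectedComponent := by
  classical
  obtain ⟨T, hT, hspan⟩ := exists_linearIndepOn_forall_span_superlevel G.edgeVec μ ρ hμ
  have hrank : ∀ i, Module.finrank ℝ (Submodule.span ℝ (G.edgeVec '' {l | i ≤ μ l})) ≤
      (T.toFinset.filter fun l => i ≤ μ l).card := by
    intro i
    have h1 : G.edgeVec '' {l ∈ T | i ≤ μ l} =
        (((T.toFinset.filter fun l => i ≤ μ l).image G.edgeVec : Finset (V → ℝ)) : Set _) := by
      simp
    calc _ ≤ Module.finrank ℝ (Submodule.span ℝ (G.edgeVec '' {l ∈ T | i ≤ μ l})) := by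
          have := Fintype.ofFinite V
          exact Submodule.finrank_mono (Submodule.span_le.2 (hspan i))
      _ ≤ _ := by
        rw [h1]
        exact (finrank_span_finset_le_card _).trans Finset.card_image_le
  refine ⟨T.toFinset, by simpa using hT, ?_, fun i => ?_⟩
  · have h := G.whole.ncard_verts_le_finrank_span
    have h0 := hrank 0
    have h1 : Nat.card G.whole.adjGraph.ConnectedComponent = 1 := by
      have := hG.preconnected.subsingleton_connectedComponent
      have := hG.nonempty
      exact Nat.card_unique
    simp only [whole, Set.ncard_univ] at h h1
    have h2 : {l | 0 ≤ μ l} = Set.univ := Set.eq_univ_of_forall fun l => Nat.zero_le _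
    rw [h2] at h0
    rw [h1] at h
    refine h.trans (Nat.add_le_add_right (h0.trans ?_) 1)
    exact Finset.card_le_card (Finset.filter_subset _ _)
  · exact ((G.scaleSub μ i).ncard_verts_le_finrank_span).trans (Nat.add_le_add_right (hrank i) _)

/-- Counting the slots of the subgraph: `N + 2 L = 4 n`. -/
theorem Sub.numLegs_add_two_mul_ncard_lines [Finite V] {G : Phi4Graph V L E}
    (H : G.Sub) : H.numLegs + 2 * H.lines.ncard = 4 * H.verts.ncard := by
  set f : L × Bool → V × Fin 4 := fun x => G.slot (Sum.inl x)
  have hf : Function.Injective f := G.slot.injective.comp Sum.inl_injective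
  have h1 : {s : V × Fin 4 | s.1 ∈ H.verts ∧ ∀ l ∈ H.lines, ∀ b, G.slot (Sum.inl (l, b)) ≠ s} =
      (H.verts ×ˢ Set.univ) \ f '' (H.lines ×ˢ Set.univ) := by
    ext s
    simp only [Set.mem_ofPred_eq, Set.mem_sdiff, Set.mem_prod, Set.mem_univ, and_true, Set.mem_image,
      not_exists, not_and, Prod.forall, f]
    grind
  have h2 : f '' (H.lines ×ˢ Set.univ) ⊆ H.verts ×ˢ Set.univ := by
    rintro _ ⟨⟨l, b⟩, ⟨hl, -⟩, rfl⟩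
    exact ⟨H.endpt_mem l hl b, trivial⟩
  have h3 := Set.ncard_sdiff_add_ncard_of_subset h2
  rw [← h1, Set.ncard_image_of_injective _ hf, Set.ncard_prod, Set.ncard_prod] at h3
  simp only [Set.ncard_univ, Nat.card_eq_fintype_card, Fintype.card_bool, Fintype.card_fin] at h3
  rw [numLegs]
  omega

/-- The power counting in terms of lines and vertices: `-ω = (D - 2) L - D (n - 1)`. -/
theorem Sub.neg_omega_eq [Finite V] {G : Phi4Graph V L E} (D : ℕ)
    (H : G.Sub) : -H.omega D = ((D : ℝ) - 2) * H.lines.ncard - D * (H.verts.ncard - 1) := by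
  have h : (H.numLegs : ℝ) + 2 * H.lines.ncard = 4 * H.verts.ncard := by
    exact_mod_cast H.numLegs_add_two_mul_ncard_lines
  rw [omega, numVerts, eq_sub_of_add_eq h]
  ring

theorem Sub.finprod_rpow_neg_omega_component [Finite V] [Finite L] {G : Phi4Graph V L E} (D : ℕ)
    {M : ℝ} (hM : 0 < M) (H : G.Sub) :
    ∏ᶠ c : H.adjGraph.ConnectedComponent, M ^ (-(H.component c).omega D) =
      M ^ (((D : ℝ) - 2) * H.lines.ncard -
        D * (H.verts.ncard - Nat.card H.adjGraph.ConnectedComponent)) := by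
  have := Fintype.ofFinite H.adjGraph.ConnectedComponent
  rw [finprod_eq_prod_of_fintype, ← Real.rpow_sum_of_pos hM]
  congr 1
  simp_rw [Sub.neg_omega_eq]
  have h1 := Set.ncard_eq_sum_ncard_fiber H.verts H.adjGraph.connectedComponentMk
  have h2 := Set.ncard_eq_sum_ncard_fiber H.lines fun l =>
    H.adjGraph.connectedComponentMk ⟨G.endpt l false, H.endpt_mem l l.2 false⟩
  rw [h1, h2, Finset.sum_sub_distrib, ← Finset.mul_sum, ← Finset.mul_sum, Finset.sum_sub_distrib]
  push_cast
  simp [component]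

/-- Each line of scale `μ l` lies in the subgraphs of scales `0, …, μ l`, so that the product over the
quasilocal subgraphs is, up to the factors from the `+ 1` in the number of these scales, at least the
product of `M ^ ((D - 2) μ l)` over all lines and of `M ^ (-D μ l)` over the lines of a spanning tree
adapted to `μ`. -/
theorem prod_rpow_neg_omega_ge [Finite V] [Fintype L] (G : Phi4Graph V L E)
    (D : ℕ) {M : ℝ} (hM : 1 < M) (ρ : ℕ) (μ : L → ℕ) (hμ : ∀ l, μ l ≤ ρ) (T : Finset L)
    (hT : ∀ i, (G.scaleSub μ i).verts.ncard ≤ (T.filter fun l => i ≤ μ l).card +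
        Nat.card (G.scaleSub μ i).adjGraph.ConnectedComponent) :
    M ^ (((D : ℝ) - 2) * ∑ l, (μ l : ℝ) - D * ∑ l ∈ T, (μ l : ℝ)) ≤
      M ^ (2 * Fintype.card L : ℝ) * ∏ i ∈ Finset.range (ρ + 1),
        ∏ᶠ c : (G.scaleSub μ i).adjGraph.ConnectedComponent,
          M ^ (-((G.scaleSub μ i).component c).omega D) := by
  have hM0 : 0 < M := by linarith
  simp_rw [Sub.finprod_rpow_neg_omega_component D hM0]
  rw [← Real.rpow_sum_of_pos hM0, ← Real.rpow_add hM0]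
  refine Real.rpow_le_rpow_of_exponent_le hM.le ?_
  -- a line of scale `μ l` is counted once for each `i = 0, …, μ l`
  have count : ∀ S : Finset L, ∑ i ∈ Finset.range (ρ + 1), ((S.filter fun l => i ≤ μ l).card : ℝ) =
      ∑ l ∈ S, ((μ l : ℝ) + 1) := by
    intro S
    simp_rw [Finset.card_filter, Nat.cast_sum]
    rw [Finset.sum_comm]
    refine Finset.sum_congr rfl fun l _ => ?_
    have : (Finset.range (ρ + 1)).filter (fun i => i ≤ μ l) = Finset.range (μ l + 1) := by
      ext i; simp; have := hμ l; omega
    rw [← Nat.cast_sum, ← Finset.card_filter, this]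
    simp
  have hlines : ∀ i, (G.scaleSub μ i).lines.ncard =
      ((Finset.univ : Finset L).filter fun l => i ≤ μ l).card := by
    intro i
    rw [← Set.ncard_coe_finset]
    simp [scaleSub]
  have hcomp : ∀ i, ((G.scaleSub μ i).verts.ncard : ℝ) -
      Nat.card (G.scaleSub μ i).adjGraph.ConnectedComponent ≤ (T.filter fun l => i ≤ μ l).card := by
    intro i
    rw [sub_le_iff_le_add]
    exact_mod_cast hT i
  have hsum : ∑ i ∈ Finset.range (ρ + 1), (((D : ℝ) - 2) *
      ((Finset.univ : Finset L).filter fun l => i ≤ μ l).card -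
        D * (T.filter fun l => i ≤ μ l).card) ≤ ∑ i ∈ Finset.range (ρ + 1),
        (((D : ℝ) - 2) * (G.scaleSub μ i).lines.ncard - D * ((G.scaleSub μ i).verts.ncard -
          Nat.card (G.scaleSub μ i).adjGraph.ConnectedComponent)) := by
    refine Finset.sum_le_sum fun i _ => ?_
    rw [hlines]
    gcongr
    exact hcomp i
  rw [Finset.sum_sub_distrib, ← Finset.mul_sum, ← Finset.mul_sum, count, count,
    Finset.sum_add_distrib, Finset.sum_add_distrib] at hsum
  have hTL : (D : ℝ) * T.card ≤ D * Fintype.card L := by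
    gcongr
    exact Finset.card_le_univ T
  simp only [Finset.sum_const, nsmul_eq_mul, mul_one, Finset.card_univ] at hsum
  linarith

end Phi4Graph

/-! ### Integrals of products -/

theorem MeasureTheory.lintegral_fin_nat_prod_eq_prod {n : ℕ} {α : Type*} [MeasurableSpace α]
    (μ : Measure α) [SigmaFinite μ] (f : Fin n → α → ENNReal) (hf : ∀ i, Measurable (f i)) :
    ∫⁻ x, ∏ i, f i (x i) ∂(Measure.pi fun _ => μ) = ∏ i, ∫⁻ x, f i x ∂μ := by
  induction n with
  | zero => simp
  | succ n ih =>
    have h := (measurePreserving_piFinSuccAbove (fun _ : Fin (n + 1) => μ) 0).symm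
    rw [← h.lintegral_comp_emb (MeasurableEquiv.measurableEmbedding _)]
    simp_rw [MeasurableEquiv.piFinSuccAbove_symm_apply, Fin.insertNthEquiv,
      Fin.prod_univ_succ, Fin.insertNth_zero, Equiv.coe_fn_mk, Fin.cons_succ, Fin.cons_zero]
    rw [← ih (fun i => f i.succ) fun i => hf _]
    exact lintegral_prod_mul (hf 0).aemeasurable
      (Finset.measurable_prod _ fun i _ => (hf _).comp (measurable_pi_apply i)).aemeasurable

theorem MeasureTheory.lintegral_fintype_prod_eq_prod {ι α : Type*} [Fintype ι] [MeasurableSpace α]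
    (μ : Measure α) [SigmaFinite μ] (f : ι → α → ENNReal) (hf : ∀ i, Measurable (f i)) :
    ∫⁻ x, ∏ i, f i (x i) ∂(Measure.pi fun _ => μ) = ∏ i, ∫⁻ x, f i x ∂μ := by
  let e := (Fintype.equivFin ι).symm
  rw [← (measurePreserving_piCongrLeft (fun _ => μ) e).lintegral_comp_emb
    (MeasurableEquiv.measurableEmbedding _)]
  simp_rw [← e.prod_comp, MeasurableEquiv.coe_piCongrLeft, Equiv.piCongrLeft_apply_apply]
  exact lintegral_fin_nat_prod_eq_prod μ _ fun i => hf _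

/-- The Cauchy–Schwarz inequality for two momenta with prescribed sum `-c`, where `c` only shifts
one of the two functions. -/
theorem MeasureTheory.lintegral_mul_neg_add_le {X : Type*} [AddCommGroup X] [MeasurableSpace X]
    [MeasurableAdd₂ X] [MeasurableNeg X] (ν : Measure X) [ν.IsAddLeftInvariant]
    [ν.IsNegInvariant] {f g : X → ENNReal} (hf : Measurable f) (hg : Measurable g) (c : X) :
    ∫⁻ k, f k * g (-(c + k)) ∂ν ≤
      (∫⁻ k, f k ^ (2 : ℝ) ∂ν) ^ (1 / 2 : ℝ) * (∫⁻ k, g k ^ (2 : ℝ) ∂ν) ^ (1 / 2 : ℝ) := by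
  have h := ENNReal.lintegral_mul_le_Lp_mul_Lq ν Real.HolderConjugate.two_two
    hf.aemeasurable (g := fun k => g (-(c + k))) (by fun_prop)
  have h2 : ∫⁻ k, g (-(c + k)) ^ (2 : ℝ) ∂ν = ∫⁻ k, g k ^ (2 : ℝ) ∂ν := by
    rw [lintegral_add_left_eq_self (fun k => g (-k) ^ (2 : ℝ)) c]
    exact lintegral_neg_eq_self (fun k => g k ^ (2 : ℝ))
  rw [h2] at h
  exact h

/-! ### Coordinates on the conserved momenta -/

namespace Phi4Graph

variable {V L E : Type*}

/-- The linear parametrization of the momenta at the slots that are conserved at every vertex, by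
the momenta at the first three slots of every vertex. -/
def conserving (V : Type*) (D : ℕ) : (V → Fin 3 → Mom D) →ₗ[ℝ] (V → Fin 4 → Mom D) where
  toFun x v := ![x v 0, x v 1, x v 2, -(x v 0 + x v 1 + x v 2)]
  map_add' x y := by
    funext v j
    fin_cases j <;> simp
    abel
  map_smul' r x := by
    funext v j
    fin_cases j <;> simp

theorem sum_conserving {D : ℕ} (x : V → Fin 3 → Mom D) (v : V) :
    ∑ j, conserving V D x v j = 0 := by
  simp [conserving, Fin.sum_univ_four]

theorem conserving_injective (V : Type*) (D : ℕ) : Function.Injective (conserving V D) := by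
  intro x y h
  funext v j
  have h0 := congrFun (congrFun h v) j.castSucc
  fin_cases j <;> simpa [conserving] using h0

theorem measurable_momentum (G : Phi4Graph V L E) {D : ℕ} (h : (L × Bool) ⊕ E) :
    Measurable fun P : V → Fin 4 → Mom D => G.momentum P h :=
  (measurable_pi_apply (G.slot h).2).comp (measurable_pi_apply (G.slot h).1)

variable [Fintype V]

theorem measurable_conserving {D : ℕ} : Measurable (conserving V D) :=
  (LinearMap.continuous_of_finiteDimensional _).measurable

theorem deltaMeasure_eq_map (G : Phi4Graph V L E) (D : ℕ) :
    G.deltaMeasure D = Measure.map (conserving V D) volume := by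
  set g : (Fin 3 → Mom D) → (Fin 4 → Mom D) := fun p => ![p 0, p 1, p 2, -(p 0 + p 1 + p 2)]
  have hg : Continuous g := by fun_prop
  have hinj : Function.Injective g := by
    intro x y h
    have := @conserving_injective Unit D (fun _ => x) (fun _ => y)
      (funext fun _ => h)
    exact congrFun this ()
  have hemb : MeasurableEmbedding g := hg.measurableEmbedding hinj
  have : ∀ _ : V, SigmaFinite (Measure.map g volume) := fun _ => hemb.sigmaFinite_map
  exact (Measure.pi_map_pi (μ := fun _ : V => volume) (f := fun _ => g) (hμ := this)
    fun _ => hg.aemeasurable).symm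

variable [Fintype L] [Fintype E]

theorem sum_momentum_eq (G : Phi4Graph V L E) {D : ℕ} (P : V → Fin 4 → Mom D) :
    ∑ l, (G.momentum P (Sum.inl (l, false)) + G.momentum P (Sum.inl (l, true))) +
      ∑ e, G.momentum P (Sum.inr e) = ∑ v, ∑ j, P v j := by
  rw [← Fintype.sum_prod_type', ← Equiv.sum_comp G.slot, Fintype.sum_sum_type,
    Fintype.sum_prod_type]
  simp [momentum, add_comm]

open scoped Classical in
/-- Conserved momenta are zero if they flow along the lines of a forest `T` only: a line carrying
momentum `p` from one end to the other contributes `p` times its incidence vector to the momenta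
entering the vertices, and the incidence vectors of `T` are linearly independent. -/
theorem eq_zero_of_linearIndepOn (G : Phi4Graph V L E) {D : ℕ} {T : Finset L}
    (hT : LinearIndepOn ℝ G.edgeVec (T : Set L)) (P : V → Fin 4 → Mom D)
    (hP : ∀ v, ∑ j, P v j = 0)
    (hs : ∀ l, G.momentum P (Sum.inl (l, false)) + G.momentum P (Sum.inl (l, true)) = 0)
    (hd : ∀ l ∉ T, G.momentum P (Sum.inl (l, false)) - G.momentum P (Sum.inl (l, true)) = 0)
    (hk : ∀ e, G.momentum P (Sum.inr e) = 0) : P = 0 := by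
  set p : L → Mom D := fun l => G.momentum P (Sum.inl (l, false))
  have hq : ∀ l, G.momentum P (Sum.inl (l, true)) = -p l := fun l =>
    eq_neg_of_add_eq_zero_right (hs l)
  have hpT : ∀ l ∉ T, p l = 0 := by
    intro l hl
    have h := hd l hl
    rw [hq] at h
    have h2 : (2 : ℝ) • p l = 0 := by rw [two_smul]; simpa [p] using h
    simpa using h2
  have hflow : ∀ v, ∑ l, ((if G.endpt l false = v then p l else 0) -
      if G.endpt l true = v then p l else 0) = 0 := by
    intro v
    calc _ = ∑ h, if (G.slot h).1 = v then G.momentum P h else 0 := by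
          rw [Fintype.sum_sum_type, Fintype.sum_prod_type]
          simp only [Fintype.sum_bool, hk, hq, ite_self, Finset.sum_const_zero, add_zero]
          refine Finset.sum_congr rfl fun l _ => ?_
          have h (c d : Prop) [Decidable c] [Decidable d] (x : Mom D) :
              (if c then x else 0) - (if d then x else 0) =
                (if d then -x else 0) + if c then x else 0 := by
            split_ifs <;> simp
          exact h _ _ _
      _ = ∑ s : V × Fin 4, if s.1 = v then P s.1 s.2 else 0 :=
          Equiv.sum_comp G.slot fun s => if s.1 = v then P s.1 s.2 else 0
      _ = 0 := by
          rw [Fintype.sum_prod_type, Finset.sum_eq_single v]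
          · simpa using hP v
          · intro w _ hw
            simp [hw]
          · simp
  have hp : ∀ l, p l = 0 := by
    intro l
    by_cases hl : l ∈ T
    swap
    · exact hpT l hl
    ext j
    refine linearIndepOn_finset_iff.1 hT (fun l => p l j) ?_ l hl
    rw [Finset.sum_subset (Finset.subset_univ T) fun l _ hl => by simp [hpT l hl]]
    funext v
    have h := congrArg (fun w : Mom D => w j) (hflow v)
    simp only [PiLp.zero_apply, WithLp.ofLp_sum, Finset.sum_apply] at h
    rw [Finset.sum_apply, Pi.zero_apply, ← h]
    refine Finset.sum_congr rfl fun l _ => ?_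
    simp only [edgeVec, Pi.smul_apply, Pi.sub_apply, Pi.single_apply, eq_comm (a := v),
      smul_eq_mul, mul_sub, mul_ite, mul_one, mul_zero, PiLp.sub_apply]
    congr 1 <;> split_ifs <;> rfl
  funext v j
  obtain ⟨h, hh⟩ := G.slot.surjective (v, j)
  have h1 : P v j = G.momentum P h := by simp [momentum, hh]
  rw [h1]
  obtain ⟨l, _ | _⟩ | e := h
  · exact hp l
  · rw [hq, hp, neg_zero]; rfl
  · exact hk e

/-- The labels of the independent momenta, apart from that of the leg `a`: the sum of the two
momenta of every line, their difference for the lines outside the tree `T`, and the momenta of the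
external legs other than `a` and `b`. -/
abbrev CoordIndex (T : Finset L) (a b : E) : Type _ :=
  L ⊕ {l // l ∉ T} ⊕ {e : E // e ≠ a ∧ e ≠ b}

/-- The independent momenta labelled by `CoordIndex T a b`, together with the momentum of the leg
`a`. -/
def coords (G : Phi4Graph V L E) (D : ℕ) (T : Finset L) (a b : E) :
    (V → Fin 4 → Mom D) →ₗ[ℝ] (CoordIndex T a b → Mom D) × Mom D where
  toFun P := (Sum.elim
      (fun l => G.momentum P (Sum.inl (l, false)) + G.momentum P (Sum.inl (l, true)))
      (Sum.elim
        (fun l => G.momentum P (Sum.inl (l, false)) - G.momentum P (Sum.inl (l, true)))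
        fun e => G.momentum P (Sum.inr e)),
    G.momentum P (Sum.inr a))
  map_add' P Q := by
    refine Prod.ext (funext fun h => ?_) rfl
    rcases h with l | l | e <;> simp only [momentum, Pi.add_apply, Prod.fst_add, Sum.elim_inl,
      Sum.elim_inr] <;> abel
  map_smul' r P := by
    refine Prod.ext (funext fun h => ?_) rfl
    rcases h with l | l | e <;> simp [momentum, smul_sub]

theorem coords_comp_conserving_injective (G : Phi4Graph V L E) (D : ℕ) {T : Finset L}
    (hT : LinearIndepOn ℝ G.edgeVec (T : Set L)) (a b : E) :
    Function.Injective (G.coords D T a b ∘ₗ conserving V D) := by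
  rw [injective_iff_map_eq_zero]
  intro x hx
  set P := conserving V D x with hPx
  have hx' : G.coords D T a b P = 0 := hx
  have hs : ∀ l, G.momentum P (Sum.inl (l, false)) + G.momentum P (Sum.inl (l, true)) = 0 :=
    fun l => congrFun (congrArg Prod.fst hx') (Sum.inl l)
  have hd : ∀ l ∉ T, G.momentum P (Sum.inl (l, false)) - G.momentum P (Sum.inl (l, true)) = 0 :=
    fun l hl => congrFun (congrArg Prod.fst hx') (Sum.inr (Sum.inl ⟨l, hl⟩))
  have hke : ∀ e, e ≠ a → e ≠ b → G.momentum P (Sum.inr e) = 0 :=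
    fun e ha hb => congrFun (congrArg Prod.fst hx') (Sum.inr (Sum.inr ⟨e, ha, hb⟩))
  have hka : G.momentum P (Sum.inr a) = 0 := congrArg Prod.snd hx'
  have hk' : ∀ e, e ≠ b → G.momentum P (Sum.inr e) = 0 := by
    intro e he
    by_cases ha : e = a
    · rw [ha, hka]
    · exact hke e ha he
  -- the sum of all momenta vanishes, which fixes the momentum of the leg `b`
  have hkb : G.momentum P (Sum.inr b) = 0 := by
    have h := G.sum_momentum_eq P
    rw [Finset.sum_eq_zero fun l _ => hs l, zero_add, Finset.sum_eq_single b
      (fun e _ he => hk' e he) (by simp)] at h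
    rw [h, hPx]
    exact Finset.sum_eq_zero fun v _ => sum_conserving x v
  have hP0 : P = 0 := G.eq_zero_of_linearIndepOn hT P (sum_conserving x) hs hd fun e => by
    by_cases he : e = b
    · rw [he, hkb]
    · exact hk' e he
  exact conserving_injective V D (by rw [map_zero, ← hPx, hP0])

/-- Counting the slots of the graph. -/
theorem card_eq (G : Phi4Graph V L E) :
    2 * Fintype.card L + Fintype.card E = 4 * Fintype.card V := by
  have := Fintype.card_congr G.slot
  simp at this
  omega

/-- For a spanning tree `T` the numbers of coordinates on both sides agree. -/
theorem coords_comp_conserving_surjective (G : Phi4Graph V L E) (D : ℕ) {T : Finset L}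
    (hT : LinearIndepOn ℝ G.edgeVec (T : Set L)) (hTc : Fintype.card V ≤ T.card + 1) {a b : E}
    (hab : a ≠ b) : Function.Surjective (G.coords D T a b ∘ₗ conserving V D) := by
  classical
  refine (LinearMap.injective_iff_surjective_of_finrank_eq_finrank ?_).1
    (G.coords_comp_conserving_injective D hT a b)
  -- only `≥` needs counting, as injectivity gives `≤`
  refine le_antisymm (LinearMap.finrank_le_finrank_of_injective
    (G.coords_comp_conserving_injective D hT a b)) ?_
  have hE : Fintype.card {e : E // e ≠ a ∧ e ≠ b} + 2 = Fintype.card E := by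
    rw [Fintype.card_subtype, ← Finset.card_pair hab, ← Finset.card_compl_add_card {a, b}]
    congr 2
    ext e
    simp
  have hL : Fintype.card {l // l ∉ T} + T.card = Fintype.card L := by
    rw [Fintype.card_subtype_compl, Fintype.card_coe]
    have := Finset.card_le_univ T
    omega
  have hc := G.card_eq
  simp only [Module.finrank_prod, Module.finrank_pi_fintype, finrank_euclideanSpace,
    Fintype.card_fin, Finset.sum_const, Finset.card_univ, smul_eq_mul, Fintype.card_sum]
  calc _ = (Fintype.card L + Fintype.card {l // l ∉ T} +
          Fintype.card {e : E // e ≠ a ∧ e ≠ b} + 1) * D := by ring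
    _ ≤ (Fintype.card V * 3) * D := by
        gcongr
        omega
    _ = _ := by ring

/-- In the coordinates `coords` the measure `Δ` is a multiple of the Lebesgue measure, by uniqueness of
the Haar measure. The value of the Jacobian does not matter. -/
theorem exists_lintegral_coords_eq [DecidableEq L] [DecidableEq E] (G : Phi4Graph V L E)
    (D : ℕ) {T : Finset L} (hT : LinearIndepOn ℝ G.edgeVec (T : Set L))
    (hTc : Fintype.card V ≤ T.card + 1) {a b : E} (hab : a ≠ b) :
    ∃ c : ENNReal, c ≠ ⊤ ∧ ∀ h : (CoordIndex T a b → Mom D) × Mom D → ENNReal, Measurable h →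
      ∫⁻ P, h (G.coords D T a b P) ∂(G.deltaMeasure D) = c * ∫⁻ y, h y := by
  have : (volume : Measure ((CoordIndex T a b → Mom D) × Mom D)).IsAddHaarMeasure :=
    Measure.prod.instIsAddHaarMeasure _ _
  have hX : (volume : Measure (V → Fin 3 → Mom D)).IsAddHaarMeasure :=
    Measure.pi.isAddHaarMeasure _
  have hsurj := G.coords_comp_conserving_surjective D hT hTc hab
  let e := (LinearEquiv.ofBijective _
    ⟨G.coords_comp_conserving_injective D hT a b, hsurj⟩).toContinuousLinearEquiv
  have hH : (Measure.map e volume).IsAddHaarMeasure := e.isAddHaarMeasure_map volume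
  obtain ⟨c, hc⟩ : ∃ c : NNReal, Measure.map e volume = c • volume :=
    ⟨_, Measure.isAddLeftInvariant_eq_smul (Measure.map e volume) volume⟩
  refine ⟨c, ENNReal.coe_ne_top, fun h hh => ?_⟩
  have hmeas : Measurable (G.coords D T a b) :=
    (LinearMap.continuous_of_finiteDimensional _).measurable
  rw [deltaMeasure_eq_map, lintegral_map (f := fun P => h (G.coords D T a b P)) (hh.comp hmeas)
    measurable_conserving]
  calc _ = ∫⁻ y, h y ∂(Measure.map e volume) := by
        rw [lintegral_map hh e.continuous.measurable]
        rfl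
    _ = _ := by
        rw [hc, lintegral_smul_measure]
        rfl

/-- The basic estimate on the integral over conserved momenta: the sums of momenta of all lines, the
differences of those of the lines outside the tree, and the momenta of all legs but `a` and `b` are
integrated independently, which leaves the overall momentum conservation for the Cauchy–Schwarz
inequality in the momenta of `a` and `b`. -/
theorem exists_lintegral_deltaMeasure_le [DecidableEq L] [DecidableEq E] (G : Phi4Graph V L E)
    (D : ℕ) {T : Finset L}
    (hT : LinearIndepOn ℝ G.edgeVec (T : Set L)) (hTc : Fintype.card V ≤ T.card + 1) {a b : E}
    (hab : a ≠ b) : ∃ c : ENNReal, c ≠ ⊤ ∧ ∀ (g g' : L → Mom D → ENNReal) (F : E → Mom D → ENNReal),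
      (∀ l, Measurable (g l)) → (∀ l, Measurable (g' l)) → (∀ e, Measurable (F e)) →
      ∫⁻ P, (∏ l, g l (G.momentum P (Sum.inl (l, false)) + G.momentum P (Sum.inl (l, true)))) *
        (∏ l ∈ Tᶜ, g' l (G.momentum P (Sum.inl (l, false)) - G.momentum P (Sum.inl (l, true)))) *
        ∏ e, F e (G.momentum P (Sum.inr e)) ∂(G.deltaMeasure D) ≤
      c * ((∏ l, ∫⁻ s, g l s) * (∏ l ∈ Tᶜ, ∫⁻ d, g' l d) *
        (∏ e ∈ (Finset.univ.erase a).erase b, ∫⁻ k, F e k) *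
        ((∫⁻ k, F a k ^ (2 : ℝ)) ^ (1 / 2 : ℝ) * (∫⁻ k, F b k ^ (2 : ℝ)) ^ (1 / 2 : ℝ))) := by
  obtain ⟨c, hc, hcoords⟩ := G.exists_lintegral_coords_eq D hT hTc hab
  refine ⟨c, hc, fun g g' F hg hg' hF => ?_⟩
  have hprodT : ∀ w : L → ENNReal, ∏ l ∈ Tᶜ, w l = ∏ l : {l // l ∉ T}, w l := fun w =>
    Finset.prod_subtype _ (by simp) _
  have hprodE : ∀ w : E → ENNReal, ∏ e ∈ (Finset.univ.erase a).erase b, w e =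
      ∏ e : {e : E // e ≠ a ∧ e ≠ b}, w e := fun w =>
    Finset.prod_subtype _ (by simp [and_comm]) _
  set f : CoordIndex T a b → Mom D → ENNReal :=
    Sum.elim g (Sum.elim (fun l => g' l) fun e => F e)
  have hf : ∀ i, Measurable (f i) := by
    rintro (l | l | e)
    exacts [hg l, hg' l, hF e]
  set r : (CoordIndex T a b → Mom D) → Mom D := fun y =>
    ∑ l, y (Sum.inl l) + ∑ e, y (Sum.inr (Sum.inr e))
  have hr : Measurable r := by fun_prop
  have hfprod : Measurable fun y : CoordIndex T a b → Mom D => ∏ i, f i (y i) :=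
    Finset.measurable_prod _ fun i _ => (hf i).comp (measurable_pi_apply i)
  set h : (CoordIndex T a b → Mom D) × Mom D → ENNReal := fun y =>
    (∏ i, f i (y.1 i)) * (F a y.2 * F b (-(r y.1 + y.2)))
  have hh : Measurable h := (hfprod.comp measurable_fst).mul
    (((hF a).comp measurable_snd).mul ((hF b).comp (by fun_prop)))
  -- overall momentum conservation
  have hcons : ∀ᵐ P ∂(G.deltaMeasure D), ∑ v, ∑ j, P v j = 0 := by
    rw [deltaMeasure_eq_map, ae_map_iff measurable_conserving.aemeasurable
      (measurableSet_eq_fun (by fun_prop) (by fun_prop))]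
    exact Filter.Eventually.of_forall fun x => Finset.sum_eq_zero fun v _ => sum_conserving x v
  calc _ = ∫⁻ P, h (G.coords D T a b P) ∂(G.deltaMeasure D) := by
        refine lintegral_congr_ae (hcons.mono fun P hP => ?_)
        have hb : G.momentum P (Sum.inr b) =
            -(r (G.coords D T a b P).1 + (G.coords D T a b P).2) := by
          rw [← G.sum_momentum_eq P, ← Finset.add_sum_erase _ _ (Finset.mem_univ a),
            ← Finset.add_sum_erase _ _ (Finset.mem_erase.2 ⟨hab.symm, Finset.mem_univ b⟩),
            Finset.sum_subtype (p := fun e => e ≠ a ∧ e ≠ b) _ (by simp [and_comm])] at hP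
          rw [eq_neg_iff_add_eq_zero, ← hP]
          simp only [r, coords, LinearMap.coe_mk, AddHom.coe_mk, Sum.elim_inl, Sum.elim_inr]
          abel
        have hE : ∏ e, F e (G.momentum P (Sum.inr e)) =
            (∏ e : {e : E // e ≠ a ∧ e ≠ b}, F e (G.momentum P (Sum.inr e))) *
              (F a (G.momentum P (Sum.inr a)) * F b (G.momentum P (Sum.inr b))) := by
          rw [← Finset.mul_prod_erase _ _ (Finset.mem_univ a),
            ← Finset.mul_prod_erase _ _ (Finset.mem_erase.2 ⟨hab.symm, Finset.mem_univ b⟩),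
            hprodE fun e => F e (G.momentum P (Sum.inr e))]
          ring
        simp only [h]
        rw [hE, hprodT fun l => g' l _, hb, Fintype.prod_sum_type, Fintype.prod_sum_type]
        simp only [f, coords, LinearMap.coe_mk, AddHom.coe_mk, Sum.elim_inl, Sum.elim_inr]
        ring
    _ = c * ∫⁻ y, h y := hcoords h hh
    _ = c * ∫⁻ y : CoordIndex T a b → Mom D, (∏ i, f i (y i)) *
          ∫⁻ k, F a k * F b (-(r y + k)) := by
        congr 1
        refine (lintegral_prod h hh.aemeasurable).trans (lintegral_congr fun y => ?_)
        have hk : Measurable fun k => F a k * F b (-(r y + k)) :=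
          (hF a).mul ((hF b).comp (measurable_const_add (r y)).neg)
        exact lintegral_const_mul (∏ i, f i (y i)) hk
    _ ≤ c * ∫⁻ y : CoordIndex T a b → Mom D, (∏ i, f i (y i)) *
          ((∫⁻ k, F a k ^ (2 : ℝ)) ^ (1 / 2 : ℝ) * (∫⁻ k, F b k ^ (2 : ℝ)) ^ (1 / 2 : ℝ)) := by
        gcongr with y
        exact lintegral_mul_neg_add_le volume (hF a) (hF b) _
    _ = _ := by
        rw [lintegral_mul_const _ hfprod, hprodT fun l => ∫⁻ d, g' l d,
          hprodE fun e => ∫⁻ k, F e k, volume_pi, lintegral_fintype_prod_eq_prod _ f hf,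
          Fintype.prod_sum_type, Fintype.prod_sum_type]
        simp only [f, Sum.elim_inl, Sum.elim_inr, mul_assoc]

end Phi4Graph

/-! ### Bounds on the sliced propagator -/

theorem Real.sinh_le_self_mul_exp (x : ℝ) : Real.sinh x ≤ x * Real.exp x := by
  have h := Real.add_one_le_exp (-(2 * x))
  have h2 : Real.exp (-(2 * x)) * Real.exp x = Real.exp (-x) := by
    rw [← Real.exp_add]; ring_nf
  rw [Real.sinh_eq]
  nlinarith [Real.exp_pos x]

theorem Real.inv_two_mul_le_cosh_div_sinh {x : ℝ} (hx : 0 < x) :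
    (2 * x)⁻¹ ≤ Real.cosh x / Real.sinh x := by
  have hs := Real.sinh_pos_iff.2 hx
  rw [le_div_iff₀ hs, inv_mul_le_iff₀ (by positivity)]
  have h := Real.sinh_le_self_mul_exp x
  have hc : Real.exp x ≤ 2 * Real.cosh x := by
    rw [Real.cosh_eq]; linarith [Real.exp_pos (-x)]
  nlinarith

theorem Real.one_le_cosh_div_sinh {x : ℝ} (hx : 0 < x) : 1 ≤ Real.cosh x / Real.sinh x := by
  rw [le_div_iff₀ (Real.sinh_pos_iff.2 hx), one_mul]
  exact (Real.sinh_lt_cosh x).le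

theorem Real.div_cosh_le_tanh {x y : ℝ} (hx : 0 ≤ x) (hxy : x ≤ y) :
    x / Real.cosh y ≤ Real.tanh x := by
  rw [Real.tanh_eq_sinh_div_cosh]
  have h := Real.self_le_sinh_iff.2 hx
  have := Real.cosh_pos x
  gcongr
  exact Real.cosh_le_cosh.2 (by rwa [abs_of_nonneg hx, abs_of_nonneg (hx.trans hxy)])

theorem Real.tanh_le_tanh_of_le {x y : ℝ} (hxy : x ≤ y) : Real.tanh x ≤ Real.tanh y := by
  rw [Real.tanh_eq_sinh_div_cosh, Real.tanh_eq_sinh_div_cosh,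
    div_le_div_iff₀ (Real.cosh_pos x) (Real.cosh_pos y)]
  have h := Real.sinh_nonneg_iff.2 (sub_nonneg.2 hxy)
  rw [Real.sinh_sub] at h
  linarith

theorem Real.mul_exp_le_sinh {x y : ℝ} (hxy : x ≤ y) :
    (1 - Real.exp (-(2 * x))) / 2 * Real.exp y ≤ Real.sinh y := by
  have h : Real.exp (-(2 * y)) ≤ Real.exp (-(2 * x)) := Real.exp_le_exp.2 (by linarith)
  have h2 : Real.exp (-(2 * y)) * Real.exp y = Real.exp (-y) := by
    rw [← Real.exp_add]; ring_nf
  rw [Real.sinh_eq]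
  nlinarith [Real.exp_pos y]

theorem propagatorKernel_nonneg (D : ℕ) {Ω t : ℝ} (m : ℝ) (hΩ : 0 < Ω) (ht : 0 ≤ t) (p q : Mom D) :
    0 ≤ propagatorKernel D Ω m t p q := by
  have : 0 ≤ Real.sinh (2 * Ω * t) := Real.sinh_nonneg_iff.2 (by positivity)
  rw [propagatorKernel]
  positivity

theorem propagatorKernel_le (D : ℕ) {Ω t : ℝ} (m : ℝ) (hΩ : 0 < Ω) (ht : 0 ≤ t) {α β : ℝ}
    (hα : α ≤ 1 / (4 * Ω) * (Real.cosh (Ω * t) / Real.sinh (Ω * t)))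
    (hβ : β ≤ 1 / (4 * Ω) * Real.tanh (Ω * t)) (p q : Mom D) :
    propagatorKernel D Ω m t p q ≤
      Real.exp (-m ^ 2 * t) / Real.sinh (2 * Ω * t) ^ ((D : ℝ) / 2) *
        (Real.exp (-α * ‖p + q‖ ^ 2) * Real.exp (-β * ‖p - q‖ ^ 2)) := by
  have : 0 ≤ Real.sinh (2 * Ω * t) := Real.sinh_nonneg_iff.2 (by positivity)
  rw [propagatorKernel, ← Real.exp_add]
  gcongr
  have h1 := mul_le_mul_of_nonneg_right hα (sq_nonneg ‖p + q‖)
  have h2 := mul_le_mul_of_nonneg_right hβ (sq_nonneg ‖p - q‖)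
  linarith

/-- This is where `0 < D ∨ m ≠ 0` enters: the integrand decays like `exp (-(m² + Ω D) t)`. -/
theorem integrableOn_exp_div_sinh_rpow (D : ℕ) (Ω m : ℝ) (hΩ : 0 < Ω) (hDm : 0 < D ∨ m ≠ 0) :
    IntegrableOn (fun t => Real.exp (-m ^ 2 * t) / Real.sinh (2 * Ω * t) ^ ((D : ℝ) / 2))
      (Set.Ici 1) := by
  set c := (1 - Real.exp (-(2 * (2 * Ω)))) / 2
  have hc : 0 < c := by
    have : Real.exp (-(2 * (2 * Ω))) < 1 := Real.exp_lt_one_iff.2 (by linarith)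
    simp only [c]
    linarith
  have hκ : -(m ^ 2 + Ω * D) < 0 := by
    rcases hDm with h | h
    · have : (0 : ℝ) < D := by exact_mod_cast h
      have : 0 < Ω * D := by positivity
      nlinarith [sq_nonneg m]
    · have : 0 < m ^ 2 := by positivity
      have : 0 ≤ Ω * D := by positivity
      linarith
  have hint : IntegrableOn (fun t => (c ^ ((D : ℝ) / 2))⁻¹ * Real.exp (-(m ^ 2 + Ω * D) * t))
      (Set.Ici 1) :=
    Integrable.const_mul ((integrableOn_Ici_iff_integrableOn_Ioi).2 (integrableOn_exp_mul_Ioi hκ 1)) _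
  refine Integrable.mono' hint (Measurable.aestronglyMeasurable (by fun_prop)) ?_
  refine (ae_restrict_iff' measurableSet_Ici).2 (Filter.Eventually.of_forall fun t ht => ?_)
  have ht1 : (1 : ℝ) ≤ t := ht
  have h1 : c * Real.exp (2 * Ω * t) ≤ Real.sinh (2 * Ω * t) :=
    Real.mul_exp_le_sinh (by nlinarith)
  have h0 : 0 < c * Real.exp (2 * Ω * t) := by positivity
  have hs : 0 < Real.sinh (2 * Ω * t) := h0.trans_le h1
  rw [Real.norm_of_nonneg (by positivity)]
  calc _ ≤ Real.exp (-m ^ 2 * t) / (c * Real.exp (2 * Ω * t)) ^ ((D : ℝ) / 2) := by gcongr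
    _ = _ := by
      rw [Real.mul_rpow hc.le (Real.exp_pos _).le, ← Real.exp_mul, div_eq_inv_mul, mul_inv,
        ← Real.exp_neg, mul_assoc, ← Real.exp_add]
      ring_nf

theorem measurable_slicePropagator (D : ℕ) (Ω m M : ℝ) (i : ℕ) :
    Measurable fun x : Mom D × Mom D => slicePropagator D Ω m M i x.1 x.2 := by
  refine Measurable.const_mul (StronglyMeasurable.measurable ?_) _
  refine StronglyMeasurable.integral_prod_right'
    (f := fun z : (Mom D × Mom D) × ℝ => propagatorKernel D Ω m z.2 z.1.1 z.1.2) ?_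
  refine Measurable.stronglyMeasurable ?_
  simp only [propagatorKernel, Real.tanh_eq_sinh_div_cosh]
  fun_prop

theorem Measurable.slicePropagator {α : Type*} [MeasurableSpace α] (D : ℕ) (Ω m M : ℝ) (i : ℕ)
    {p q : α → Mom D} (hp : Measurable p) (hq : Measurable q) :
    Measurable fun x => slicePropagator D Ω m M i (p x) (q x) := by
  have h := (measurable_slicePropagator D Ω m M i).comp (hp.prodMk hq)
  simpa only [Function.comp_def] using h

theorem slicePropagator_nonneg (D : ℕ) {Ω M : ℝ} (m : ℝ) (hΩ : 0 < Ω) (hM : 0 ≤ M) (i : ℕ)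
    (p q : Mom D) : 0 ≤ slicePropagator D Ω m M i p q := by
  refine mul_nonneg (by positivity) (setIntegral_nonneg ?_ fun t ht =>
    propagatorKernel_nonneg D m hΩ ?_ p q)
  · cases i
    exacts [measurableSet_Ici, measurableSet_Icc]
  · cases i with
    | zero => exact zero_le_one.trans ht
    | succ i => exact le_trans (by positivity) ht.1

/-- The slice of scale `i` restricts the sum of the two momenta to size `M ^ (-i)` and their
difference to size `M ^ i`, with prefactor `M ^ ((D - 2) i)`. -/
theorem exists_slicePropagator_le (D : ℕ) (Ω m M : ℝ) (hΩ : 0 < Ω) (hM : 1 < M)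
    (hDm : 0 < D ∨ m ≠ 0) :
    ∃ K c : ℝ, 0 < K ∧ 0 < c ∧ ∀ (i : ℕ) (p q : Mom D), slicePropagator D Ω m M i p q ≤
      K * M ^ (((D : ℝ) - 2) * i) * (Real.exp (-(c * M ^ (2 * i)) * ‖p + q‖ ^ 2) *
        Real.exp (-(c * (M ^ (2 * i))⁻¹) * ‖p - q‖ ^ 2)) := by
  have hM0 : 0 < M := by linarith
  have hcosh := Real.cosh_pos Ω
  have htanh : 0 < Real.tanh Ω := by
    rw [Real.tanh_eq_sinh_div_cosh]
    exact div_pos (Real.sinh_pos_iff.2 hΩ) hcosh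
  set w : ℝ → ℝ := fun t => Real.exp (-m ^ 2 * t) / Real.sinh (2 * Ω * t) ^ ((D : ℝ) / 2)
  -- `K₀` bounds the slice `i = 0`, and `K₁` all others
  set K₀ := ∫ t in Set.Ici 1, w t
  set K₁ := (M ^ 2 - 1) / (2 * Ω) ^ ((D : ℝ) / 2)
  -- the three entries come from `tanh` for `t ≥ 1`, and from `coth` and `tanh` for `t ≤ 1`
  set c := min (Real.tanh Ω / (4 * Ω)) (min (1 / (8 * Ω ^ 2 * M ^ 2)) (1 / (4 * Real.cosh Ω)))
  have hc : 0 < c := by positivity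
  have hc0 : c ≤ Real.tanh Ω / (4 * Ω) := min_le_left _ _
  have hc1 : c ≤ 1 / (8 * Ω ^ 2 * M ^ 2) := (min_le_right _ _).trans (min_le_left _ _)
  have hc2 : c ≤ 1 / (4 * Real.cosh Ω) := (min_le_right _ _).trans (min_le_right _ _)
  have hK₀ : 0 ≤ K₀ := setIntegral_nonneg measurableSet_Ici fun t ht => by
    have ht1 : (0 : ℝ) ≤ t := zero_le_one.trans ht
    have : 0 ≤ Real.sinh (2 * Ω * t) := Real.sinh_nonneg_iff.2 (by positivity)
    positivity
  have hK₁ : 0 < K₁ := div_pos (by nlinarith) (by positivity)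
  refine ⟨(2 * Real.pi / Ω) ^ ((D : ℝ) / 2) * (K₀ + K₁), c, by positivity, hc, fun i p q => ?_⟩
  set g := Real.exp (-(c * M ^ (2 * i)) * ‖p + q‖ ^ 2) *
    Real.exp (-(c * (M ^ (2 * i))⁻¹) * ‖p - q‖ ^ 2)
  have hg : 0 < g := by positivity
  rw [slicePropagator, mul_assoc, mul_assoc]
  gcongr
  rw [← mul_assoc]
  cases i with
  | zero =>
    calc _ ≤ ∫ t in Set.Ici 1, w t * g := by
          refine integral_mono_of_nonneg ?_
            ((integrableOn_exp_div_sinh_rpow D Ω m hΩ hDm).mul_const g) ?_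
          · refine (ae_restrict_iff' measurableSet_Ici).2 (Filter.Eventually.of_forall fun t ht => ?_)
            exact propagatorKernel_nonneg D m hΩ (zero_le_one.trans ht) p q
          · refine (ae_restrict_iff' measurableSet_Ici).2 (Filter.Eventually.of_forall fun t ht => ?_)
            have ht1 : (1 : ℝ) ≤ t := ht
            have hΩt : Ω ≤ Ω * t := le_mul_of_one_le_right hΩ.le ht1
            have hβ : Real.tanh Ω / (4 * Ω) ≤ 1 / (4 * Ω) * Real.tanh (Ω * t) := by
              rw [div_eq_inv_mul, one_div]
              gcongr
              exact Real.tanh_le_tanh_of_le hΩt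
            refine propagatorKernel_le D m hΩ (by linarith) ?_ ?_ p q
            · calc _ = c := by simp
                _ ≤ Real.tanh Ω / (4 * Ω) := hc0
                _ ≤ 1 / (4 * Ω) * 1 := by
                  rw [mul_one]
                  gcongr
                  exact (Real.tanh_lt_one Ω).le
                _ ≤ _ := by
                  gcongr
                  exact Real.one_le_cosh_div_sinh (by positivity)
            · simpa using hc0.trans hβ
      _ = K₀ * g := integral_mul_const _ _
      _ ≤ _ := by
        gcongr
        simp
        exact hK₁.le
  | succ i =>
    set A := M ^ (2 * (i + 1)) with hA
    have hA0 : 0 < A := by positivity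
    have hAi : (M ^ (2 * i))⁻¹ = M ^ 2 * A⁻¹ := by
      rw [hA, mul_add, pow_add]
      field_simp
    have hA1 : M ^ 2 * A⁻¹ ≤ 1 := by
      rw [← hAi]
      exact inv_le_one_of_one_le₀ (one_le_pow₀ hM.le)
    have hpow : A ^ ((D : ℝ) / 2) * A⁻¹ = M ^ (((D : ℝ) - 2) * (i + 1 : ℕ)) := by
      rw [hA, ← Real.rpow_natCast, ← Real.rpow_mul hM0.le, ← Real.rpow_neg hM0.le,
        ← Real.rpow_add hM0]
      congr 1
      push_cast
      ring
    have hbound : ∀ t ∈ sliceRange M (i + 1), ‖propagatorKernel D Ω m t p q‖ ≤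
        A ^ ((D : ℝ) / 2) / (2 * Ω) ^ ((D : ℝ) / 2) * g := by
      intro t ht
      have ht1 : A⁻¹ ≤ t := ht.1
      have ht2 : t ≤ M ^ 2 * A⁻¹ := hAi ▸ ht.2
      have ht0 : 0 < t := lt_of_lt_of_le (by positivity) ht1
      have hα : c * A ≤ 1 / (4 * Ω) * (Real.cosh (Ω * t) / Real.sinh (Ω * t)) := by
        calc c * A ≤ 1 / (8 * Ω ^ 2 * M ^ 2) * A := by gcongr
          _ = 1 / (4 * Ω) * (2 * (Ω * (M ^ 2 * A⁻¹)))⁻¹ := by field_simp; ring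
          _ ≤ 1 / (4 * Ω) * (2 * (Ω * t))⁻¹ := by gcongr
          _ ≤ _ := by
            gcongr
            exact Real.inv_two_mul_le_cosh_div_sinh (by positivity)
      have hβ : c * A⁻¹ ≤ 1 / (4 * Ω) * Real.tanh (Ω * t) := by
        calc c * A⁻¹ ≤ 1 / (4 * Real.cosh Ω) * t := by gcongr
          _ = 1 / (4 * Ω) * (Ω * t / Real.cosh Ω) := by field_simp
          _ ≤ _ := by
            gcongr
            exact Real.div_cosh_le_tanh (by positivity)
              (mul_le_of_le_one_right hΩ.le (ht2.trans hA1))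
      rw [Real.norm_of_nonneg (propagatorKernel_nonneg D m hΩ ht0.le p q)]
      refine (propagatorKernel_le D m hΩ ht0.le hα hβ p q).trans ?_
      gcongr ?_ * _
      have hsinh : 2 * Ω * A⁻¹ ≤ Real.sinh (2 * Ω * t) :=
        le_trans (by gcongr) (Real.self_le_sinh_iff.2 (by positivity : 0 ≤ 2 * Ω * t))
      calc _ ≤ 1 / (2 * Ω * A⁻¹) ^ ((D : ℝ) / 2) := by
            gcongr
            exact Real.exp_le_one_iff.2 (by nlinarith [sq_nonneg m])
        _ = _ := by
          rw [Real.mul_rpow (by positivity) (by positivity), Real.inv_rpow hA0.le]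
          field_simp
    have hvol : volume.real (sliceRange M (i + 1)) = (M ^ 2 - 1) * A⁻¹ := by
      have : sliceRange M (i + 1) = Set.Icc A⁻¹ (M ^ 2 * A⁻¹) := by rw [← hAi]; rfl
      rw [this, Real.volume_real_Icc_of_le]
      · ring
      · exact le_mul_of_one_le_left (by positivity) (one_le_pow₀ hM.le)
    have hfin : volume (sliceRange M (i + 1)) < ⊤ := measure_Icc_lt_top
    calc _ ≤ ‖∫ t in sliceRange M (i + 1), propagatorKernel D Ω m t p q‖ := le_abs_self _
      _ ≤ A ^ ((D : ℝ) / 2) / (2 * Ω) ^ ((D : ℝ) / 2) * g * ((M ^ 2 - 1) * A⁻¹) := by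
        rw [← hvol]
        exact norm_setIntegral_le_of_norm_le_const hfin hbound
      _ = K₁ * M ^ (((D : ℝ) - 2) * (i + 1 : ℕ)) * g := by
        rw [← hpow]
        simp only [K₁]
        ring
      _ ≤ _ := by
        gcongr
        linarith

/-! ### Gaussian integrals and Fourier transforms of Schwartz functions -/

theorem lintegral_ofReal_exp_neg_mul_sq_norm (D : ℕ) {b : ℝ} (hb : 0 < b) :
    ∫⁻ v : Mom D, ENNReal.ofReal (Real.exp (-b * ‖v‖ ^ 2)) =
      ENNReal.ofReal ((Real.pi / b) ^ ((D : ℝ) / 2)) := by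
  have h := GaussianFourier.integral_rexp_neg_mul_sq_norm (V := Mom D) hb
  rw [finrank_euclideanSpace, Fintype.card_fin] at h
  have hint : Integrable fun v : Mom D => Real.exp (-b * ‖v‖ ^ 2) :=
    Integrable.of_integral_ne_zero (by rw [h]; positivity)
  rw [← h, ofReal_integral_eq_lintegral_ofReal hint
    (Filter.Eventually.of_forall fun v => (Real.exp_pos _).le)]

/-- `fourierHat` differs from Mathlib's Fourier transform by the scaling `p ↦ p / (2π)`. -/
theorem exists_schwartzMap_eq_fourierHat {D : ℕ} (φ : SchwartzMap (Mom D) ℂ) :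
    ∃ ψ : SchwartzMap (Mom D) ℂ, ⇑ψ = fourierHat φ := by
  have h : (2 * Real.pi)⁻¹ ≠ 0 := by positivity
  refine ⟨SchwartzMap.compCLMOfContinuousLinearEquiv ℂ
    (ContinuousLinearEquiv.smulLeft (Units.mk0 _ h)) (FourierTransform.fourier φ), ?_⟩
  funext p
  rw [SchwartzMap.compCLMOfContinuousLinearEquiv_apply, Function.comp_apply,
    SchwartzMap.fourier_coe, Real.fourier_eq', fourierHat]
  refine integral_congr_ae (Filter.Eventually.of_forall fun x => ?_)
  have h2 : inner ℝ x ((2 * Real.pi)⁻¹ • p) = (2 * Real.pi)⁻¹ * inner ℝ p x := by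
    rw [inner_smul_right, real_inner_comm]
  have h3 : (ContinuousLinearEquiv.smulLeft (Units.mk0 _ h) : Mom D ≃L[ℝ] Mom D) p =
    (2 * Real.pi)⁻¹ • p := rfl
  simp only [h3, h2, smul_eq_mul, mul_comm (φ x)]
  congr 2
  push_cast
  field_simp

theorem enorm_finset_prod {ι : Type*} (s : Finset ι) (f : ι → ℂ) :
    ‖∏ i ∈ s, f i‖ₑ = ∏ i ∈ s, ‖f i‖ₑ := by
  simp [enorm_eq_nnnorm, nnnorm_prod]

/-! ### The amplitude -/

namespace Phi4Graph

variable {V L E : Type*} [Fintype L]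

/-- The Gaussian in the difference of momenta is kept only for the lines outside `T`. -/
theorem prod_slicePropagator_le [DecidableEq L] (D : ℕ) {Ω m M K c : ℝ} (hΩ : 0 < Ω)
    (hM : 0 < M) (hK : 0 ≤ K) (hc : 0 ≤ c)
    (hslice : ∀ (i : ℕ) (p q : Mom D), slicePropagator D Ω m M i p q ≤
      K * M ^ (((D : ℝ) - 2) * i) * (Real.exp (-(c * M ^ (2 * i)) * ‖p + q‖ ^ 2) *
        Real.exp (-(c * (M ^ (2 * i))⁻¹) * ‖p - q‖ ^ 2))) (μ : L → ℕ) (T : Finset L)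
    (p q : L → Mom D) :
    ∏ l, ‖(slicePropagator D Ω m M (μ l) (p l) (q l) : ℂ)‖ₑ ≤
      (∏ l, ENNReal.ofReal (K * M ^ (((D : ℝ) - 2) * μ l)) *
        ENNReal.ofReal (Real.exp (-(c * M ^ (2 * μ l)) * ‖p l + q l‖ ^ 2))) *
      ∏ l ∈ Tᶜ, ENNReal.ofReal (Real.exp (-(c * (M ^ (2 * μ l))⁻¹) * ‖p l - q l‖ ^ 2)) := by
  have hle : ∀ l, ‖(slicePropagator D Ω m M (μ l) (p l) (q l) : ℂ)‖ₑ ≤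
      ENNReal.ofReal (K * M ^ (((D : ℝ) - 2) * μ l)) *
        ENNReal.ofReal (Real.exp (-(c * M ^ (2 * μ l)) * ‖p l + q l‖ ^ 2)) *
        ENNReal.ofReal (Real.exp (-(c * (M ^ (2 * μ l))⁻¹) * ‖p l - q l‖ ^ 2)) := by
    intro l
    rw [← ofReal_norm, Complex.norm_of_nonneg (slicePropagator_nonneg D m hΩ hM.le _ _ _),
      mul_assoc, ← ENNReal.ofReal_mul (by positivity), ← ENNReal.ofReal_mul (by positivity)]
    exact ENNReal.ofReal_le_ofReal (hslice _ _ _)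
  refine (Finset.prod_le_prod' fun l _ => hle l).trans ?_
  rw [Finset.prod_mul_distrib]
  refine mul_le_mul' le_rfl (Finset.prod_le_prod_of_subset_of_le_one' (N := ENNReal)
    (Finset.subset_univ Tᶜ) fun l _ _ => ?_)
  rw [← ENNReal.ofReal_one]
  refine ENNReal.ofReal_le_ofReal (Real.exp_le_one_iff.2 ?_)
  rw [neg_mul]
  exact neg_nonpos.2 (by positivity)

/-- The integrals of the two Gaussians over the sum and over the difference of the momenta of a line
of scale `i`. -/
theorem gaussian_weight_eq (D : ℕ) {M c : ℝ} (hM : 0 < M) (hc : 0 < c) (i : ℕ) :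
    (Real.pi / (c * M ^ (2 * i))) ^ ((D : ℝ) / 2) =
        (Real.pi / c) ^ ((D : ℝ) / 2) * M ^ (-(D * i : ℝ)) ∧
    (Real.pi / (c * (M ^ (2 * i))⁻¹)) ^ ((D : ℝ) / 2) =
        (Real.pi / c) ^ ((D : ℝ) / 2) * M ^ (D * i : ℝ) := by
  have h : (M ^ (2 * i)) ^ ((D : ℝ) / 2) = M ^ (D * i : ℝ) := by
    rw [← Real.rpow_natCast, ← Real.rpow_mul hM.le]
    congr 1
    push_cast
    ring
  constructor
  · rw [← div_div, Real.div_rpow (by positivity) (by positivity), h, Real.rpow_neg hM.le,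
      div_eq_mul_inv]
  · rw [← div_div, div_inv_eq_mul, Real.mul_rpow (by positivity) (by positivity), h]

/-- The two Gaussian integrals compensate each other for the lines outside `T`, which leaves the factor
`M ^ (-D μ l)` for the lines of `T`. -/
theorem prod_weights_le [DecidableEq L] (D : ℕ) {M K κ : ℝ} (hM : 0 < M) (hK : 0 ≤ K) (hκ : 0 ≤ κ)
    (μ : L → ℕ) (T : Finset L) :
    (∏ l, K * M ^ (((D : ℝ) - 2) * μ l) * (κ * M ^ (-(D * μ l : ℝ)))) *
        ∏ l ∈ Tᶜ, κ * M ^ (D * μ l : ℝ) ≤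
      (K * κ) ^ Fintype.card L * (κ + 1) ^ Fintype.card L *
        M ^ (((D : ℝ) - 2) * ∑ l, (μ l : ℝ) - D * ∑ l ∈ T, (μ l : ℝ)) := by
  have h1 : ∏ l, K * M ^ (((D : ℝ) - 2) * μ l) * (κ * M ^ (-(D * μ l : ℝ))) =
      (K * κ) ^ Fintype.card L * (M ^ (((D : ℝ) - 2) * ∑ l, (μ l : ℝ)) *
        M ^ (-(D * ∑ l, (μ l : ℝ)))) := by
    have : ∀ l, K * M ^ (((D : ℝ) - 2) * μ l) * (κ * M ^ (-(D * μ l : ℝ))) =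
        K * κ * (M ^ (((D : ℝ) - 2) * μ l) * M ^ (-(D * μ l : ℝ))) := fun l => by ring
    simp_rw [this]
    rw [Finset.prod_mul_distrib, Finset.prod_const, Finset.prod_mul_distrib,
      ← Real.rpow_sum_of_pos hM, ← Real.rpow_sum_of_pos hM, Finset.sum_neg_distrib,
      Finset.mul_sum, Finset.mul_sum, Finset.card_univ]
  have h2 : ∏ l ∈ Tᶜ, κ * M ^ (D * μ l : ℝ) = κ ^ Tᶜ.card * M ^ (D * ∑ l ∈ Tᶜ, (μ l : ℝ)) := by
    rw [Finset.prod_mul_distrib, ← Real.rpow_sum_of_pos hM, Finset.prod_const, Finset.mul_sum]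
  have h3 : κ ^ Tᶜ.card ≤ (κ + 1) ^ Fintype.card L :=
    (pow_le_pow_left₀ hκ (by linarith) _).trans
      (pow_le_pow_right₀ (by linarith) (Finset.card_le_univ _))
  have h4 : M ^ (((D : ℝ) - 2) * ∑ l, (μ l : ℝ) - D * ∑ l ∈ T, (μ l : ℝ)) =
      M ^ (((D : ℝ) - 2) * ∑ l, (μ l : ℝ)) * M ^ (-(D * ∑ l, (μ l : ℝ))) *
        M ^ (D * ∑ l ∈ Tᶜ, (μ l : ℝ)) := by
    rw [← Real.rpow_add hM, ← Real.rpow_add hM, ← Finset.sum_add_sum_compl T]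
    congr 1
    ring
  rw [h1, h2, h4]
  calc _ = (K * κ) ^ Fintype.card L * κ ^ Tᶜ.card * (M ^ (((D : ℝ) - 2) * ∑ l, (μ l : ℝ)) *
        M ^ (-(D * ∑ l, (μ l : ℝ))) * M ^ (D * ∑ l ∈ Tᶜ, (μ l : ℝ))) := by ring
    _ ≤ _ := by gcongr

variable [Fintype E]

theorem measurable_amplitudeIntegrand (G : Phi4Graph V L E) (D : ℕ) (Ω m M : ℝ) (μ : L → ℕ)
    (f : E → Mom D → ℂ) (hf : ∀ e, Measurable (f e)) :
    Measurable (G.amplitudeIntegrand D Ω m M μ f) := by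
  have hlines := Finset.measurable_fun_prod Finset.univ fun l (_ : l ∈ Finset.univ) =>
    Complex.measurable_ofReal.comp (Measurable.slicePropagator D Ω m M (μ l)
      (G.measurable_momentum (Sum.inl (l, false))) (G.measurable_momentum (Sum.inl (l, true))))
  have hlegs := Finset.measurable_fun_prod Finset.univ fun e (_ : e ∈ Finset.univ) =>
    (hf e).comp (G.measurable_momentum (Sum.inr e))
  exact hlines.mul hlegs

variable [Fintype V]

/-- The power counting bound for a given spanning tree `T` and given legs `a`, `b`. -/
theorem exists_const_lintegral_amplitudeIntegrand_le (G : Phi4Graph V L E) (D : ℕ) (Ω m M : ℝ)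
    (hΩ : 0 < Ω) (hM : 1 < M) (hDm : 0 < D ∨ m ≠ 0) {T : Finset L}
    (hT : LinearIndepOn ℝ G.edgeVec (T : Set L)) (hTc : Fintype.card V ≤ T.card + 1) [DecidableEq E]
    {a b : E} (hab : a ≠ b) :
    ∃ K : ℝ, 0 ≤ K ∧ ∀ (μ : L → ℕ) (f : E → Mom D → ℂ), (∀ e, Measurable (f e)) →
      ∫⁻ P, ‖G.amplitudeIntegrand D Ω m M μ f P‖ₑ ∂(G.deltaMeasure D) ≤
        ENNReal.ofReal (K * M ^ (((D : ℝ) - 2) * ∑ l, (μ l : ℝ) - D * ∑ l ∈ T, (μ l : ℝ))) *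
          ((∏ e ∈ (Finset.univ.erase a).erase b, eLpNorm (f e) 1 volume) *
            (eLpNorm (f a) 2 volume * eLpNorm (f b) 2 volume)) := by
  classical
  have hM0 : 0 < M := by linarith
  obtain ⟨K, c, hK, hc, hslice⟩ := exists_slicePropagator_le D Ω m M hΩ hM hDm
  obtain ⟨C, hC, hdelta⟩ := G.exists_lintegral_deltaMeasure_le D hT hTc hab
  set κ := (Real.pi / c) ^ ((D : ℝ) / 2)
  have hκ : 0 ≤ κ := by positivity
  refine ⟨C.toReal * ((K * κ) ^ Fintype.card L * (κ + 1) ^ Fintype.card L), by positivity,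
    fun μ f hf => ?_⟩
  set g : L → Mom D → ENNReal := fun l s => ENNReal.ofReal (K * M ^ (((D : ℝ) - 2) * μ l)) *
    ENNReal.ofReal (Real.exp (-(c * M ^ (2 * μ l)) * ‖s‖ ^ 2))
  set g' : L → Mom D → ENNReal := fun l d =>
    ENNReal.ofReal (Real.exp (-(c * (M ^ (2 * μ l))⁻¹) * ‖d‖ ^ 2))
  have hg : ∀ l, ∫⁻ s, g l s =
      ENNReal.ofReal (K * M ^ (((D : ℝ) - 2) * μ l) * (κ * M ^ (-(D * μ l : ℝ)))) := by
    intro l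
    rw [ENNReal.ofReal_mul (by positivity), ← (gaussian_weight_eq D hM0 hc (μ l)).1,
      ← lintegral_ofReal_exp_neg_mul_sq_norm D (by positivity)]
    exact lintegral_const_mul _ (by fun_prop)
  have hg' : ∀ l, ∫⁻ d, g' l d = ENNReal.ofReal (κ * M ^ (D * μ l : ℝ)) := by
    intro l
    rw [← (gaussian_weight_eq D hM0 hc (μ l)).2]
    exact lintegral_ofReal_exp_neg_mul_sq_norm D (by positivity)
  calc _ ≤ ∫⁻ P, (∏ l, g l (G.momentum P (Sum.inl (l, false)) + G.momentum P (Sum.inl (l, true)))) *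
        (∏ l ∈ Tᶜ, g' l (G.momentum P (Sum.inl (l, false)) - G.momentum P (Sum.inl (l, true)))) *
        ∏ e, ‖f e (G.momentum P (Sum.inr e))‖ₑ ∂(G.deltaMeasure D) := by
        refine lintegral_mono fun P => ?_
        simp only [amplitudeIntegrand, enorm_mul, enorm_finset_prod]
        gcongr
        exact prod_slicePropagator_le D hΩ hM0 hK.le hc.le hslice μ T _ _
    _ ≤ _ := hdelta g g' (fun e k => ‖f e k‖ₑ) (fun l => by fun_prop) (fun l => by fun_prop)
        fun e => (hf e).enorm
    _ ≤ _ := by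
        have h2 : ∀ e, (∫⁻ k, ‖f e k‖ₑ ^ (2 : ℝ)) ^ (1 / 2 : ℝ) = eLpNorm (f e) 2 volume :=
          fun e => by
            rw [eLpNorm_eq_lintegral_rpow_enorm_toReal two_ne_zero ENNReal.ofNat_ne_top]
            simp
        simp only [h2, ← eLpNorm_one_eq_lintegral_enorm, hg, hg']
        rw [mul_assoc (_ * _), ← mul_assoc C, mul_assoc C.toReal, ENNReal.ofReal_mul
          ENNReal.toReal_nonneg, ENNReal.ofReal_toReal hC]
        gcongr
        rw [← ENNReal.ofReal_prod_of_nonneg fun l _ => by positivity,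
          ← ENNReal.ofReal_prod_of_nonneg fun l _ => by positivity,
          ← ENNReal.ofReal_mul (Finset.prod_nonneg fun l _ => by positivity)]
        exact ENNReal.ofReal_le_ofReal (prod_weights_le D hM0 hK.le hκ μ T)

end Phi4Graph

theorem theorem1 {V L E : Type*} [Fintype V] [Fintype L] [Fintype E] [DecidableEq E]
    (D : ℕ) (Ω m M : ℝ) (hΩ : 0 < Ω) (hM : 1 < M) (hDm : 0 < D ∨ m ≠ 0)
    (G : Phi4Graph V L E) (hG : G.whole.Connected) :
    ∃ K : ℝ, 0 < K ∧
      ∀ (ρ : ℕ) (μ : L → ℕ), (∀ l, μ l ≤ ρ) →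
      ∀ (φ : E → SchwartzMap (Mom D) ℂ) (a b : E), a ≠ b →
        MeasureTheory.Integrable
          (G.amplitudeIntegrand D Ω m M μ fun e => fourierHat (φ e)) (G.deltaMeasure D) ∧
        ‖G.smearedAmplitude D Ω m M μ fun e => fourierHat (φ e)‖ ≤
          K * (∏ e ∈ (Finset.univ.erase a).erase b,
              MeasureTheory.lpNorm (fourierHat (φ e)) 1 MeasureTheory.volume) *
            MeasureTheory.lpNorm (fourierHat (φ a)) 2 MeasureTheory.volume *
            MeasureTheory.lpNorm (fourierHat (φ b)) 2 MeasureTheory.volume *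
            ∏ i ∈ Finset.range (ρ + 1),
              ∏ᶠ c : (G.scaleSub μ i).adjGraph.ConnectedComponent,
                M ^ (-((G.scaleSub μ i).component c).omega D) := by
  have hM0 : 0 < M := by linarith
  -- The tree depends on `μ`, but there are finitely many triples `(T, a, b)`, and the sum of their
  -- constants serves for all of them. Triples that do not occur get the constant `0`.
  have hbound : ∀ x : Finset L × E × E, ∃ K : ℝ, 0 ≤ K ∧
      (LinearIndepOn ℝ G.edgeVec (x.1 : Set L) → Fintype.card V ≤ x.1.card + 1 → x.2.1 ≠ x.2.2 →
      ∀ (μ : L → ℕ) (f : E → Mom D → ℂ), (∀ e, Measurable (f e)) →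
      ∫⁻ P, ‖G.amplitudeIntegrand D Ω m M μ f P‖ₑ ∂(G.deltaMeasure D) ≤
        ENNReal.ofReal (K * M ^ (((D : ℝ) - 2) * ∑ l, (μ l : ℝ) - D * ∑ l ∈ x.1, (μ l : ℝ))) *
          ((∏ e ∈ (Finset.univ.erase x.2.1).erase x.2.2, eLpNorm (f e) 1 volume) *
            (eLpNorm (f x.2.1) 2 volume * eLpNorm (f x.2.2) 2 volume))) := by
    rintro ⟨T, a, b⟩
    by_cases h : LinearIndepOn ℝ G.edgeVec (T : Set L) ∧ Fintype.card V ≤ T.card + 1 ∧ a ≠ b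
    · obtain ⟨K, hK, hle⟩ := G.exists_const_lintegral_amplitudeIntegrand_le D Ω m M hΩ hM hDm
        h.1 h.2.1 h.2.2
      exact ⟨K, hK, fun _ _ _ => hle⟩
    · exact ⟨0, le_rfl, fun h1 h2 h3 => absurd ⟨h1, h2, h3⟩ h⟩
  choose K hK0 hK using hbound
  set S := ∑ x, K x
  have hS : 0 ≤ S := Finset.sum_nonneg fun x _ => hK0 x
  refine ⟨(S + 1) * M ^ (2 * Fintype.card L : ℝ), by positivity, fun ρ μ hμ φ a b hab => ?_⟩
  obtain ⟨T, hT, hTc, hTs⟩ := G.exists_scaled_spanningTree hG ρ μ hμ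
  rw [Nat.card_eq_fintype_card] at hTc
  have hKS : K (T, a, b) ≤ S + 1 :=
    (Finset.single_le_sum (fun x _ => hK0 x) (Finset.mem_univ _)).trans (by linarith)
  have hmem : ∀ e p, MemLp (fourierHat (φ e)) p volume := fun e p => by
    obtain ⟨ψ, hψ⟩ := exists_schwartzMap_eq_fourierHat (φ e)
    exact hψ ▸ ψ.memLp p volume
  have hmeas : ∀ e, Measurable (fourierHat (φ e)) := fun e => by
    obtain ⟨ψ, hψ⟩ := exists_schwartzMap_eq_fourierHat (φ e)
    exact hψ ▸ ψ.continuous.measurable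
  have hnorm : ∀ e p, eLpNorm (fourierHat (φ e)) p volume =
      ENNReal.ofReal (lpNorm (fourierHat (φ e)) p volume) := fun e p =>
    (ofReal_lpNorm (hmem e p)).symm
  set N := (∏ e ∈ (Finset.univ.erase a).erase b, lpNorm (fourierHat (φ e)) 1 volume) *
    (lpNorm (fourierHat (φ a)) 2 volume * lpNorm (fourierHat (φ b)) 2 volume)
  have hN1 : 0 ≤ ∏ e ∈ (Finset.univ.erase a).erase b, lpNorm (fourierHat (φ e)) 1 volume :=
    Finset.prod_nonneg fun e _ => lpNorm_nonneg
  have hN : 0 ≤ N := mul_nonneg hN1 (mul_nonneg lpNorm_nonneg lpNorm_nonneg)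
  set Q := ∏ i ∈ Finset.range (ρ + 1), ∏ᶠ c : (G.scaleSub μ i).adjGraph.ConnectedComponent,
    M ^ (-((G.scaleSub μ i).component c).omega D)
  have hpow := G.prod_rpow_neg_omega_ge D hM ρ μ hμ T hTs
  have hint : ∫⁻ P, ‖G.amplitudeIntegrand D Ω m M μ (fun e => fourierHat (φ e)) P‖ₑ
      ∂(G.deltaMeasure D) ≤ ENNReal.ofReal ((S + 1) * (M ^ (2 * Fintype.card L : ℝ) * Q) * N) := by
    refine (hK (T, a, b) hT hTc hab μ _ hmeas).trans ?_
    simp only [hnorm]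
    rw [← ENNReal.ofReal_prod_of_nonneg fun e _ => lpNorm_nonneg,
      ← ENNReal.ofReal_mul lpNorm_nonneg, ← ENNReal.ofReal_mul hN1,
      ← ENNReal.ofReal_mul (mul_nonneg (hK0 _) (by positivity))]
    refine ENNReal.ofReal_le_ofReal (mul_le_mul_of_nonneg_right ?_ hN)
    exact mul_le_mul hKS hpow (by positivity) (by linarith)
  have hInt : Integrable (G.amplitudeIntegrand D Ω m M μ fun e => fourierHat (φ e))
      (G.deltaMeasure D) :=
    ⟨(G.measurable_amplitudeIntegrand D Ω m M μ _ hmeas).aestronglyMeasurable,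
      hint.trans_lt ENNReal.ofReal_lt_top⟩
  refine ⟨hInt, ?_⟩
  have hQ : 0 ≤ Q := Finset.prod_nonneg fun i _ => finprod_nonneg fun c => by positivity
  calc _ ≤ ∫ P, ‖G.amplitudeIntegrand D Ω m M μ (fun e => fourierHat (φ e)) P‖
          ∂(G.deltaMeasure D) := norm_integral_le_integral_norm _
    _ ≤ (S + 1) * (M ^ (2 * Fintype.card L : ℝ) * Q) * N := by
        rw [integral_norm_eq_lintegral_enorm hInt.aestronglyMeasurable]
        exact ENNReal.toReal_le_of_le_ofReal (by positivity) hint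
    _ = _ := by
        simp only [N]
        ring
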